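/- Let $0<q<1$ and let $\alpha,\beta>1$ be real with $0<\alpha q<1$ and $0<\beta q<1$. Let $N\in\mathbb N_0$ and $n\in\{0,1,\dots,N\}$; if $n=2$, assume in addition that $\alpha\beta q<1$ (for $n\ge 3$ no such condition is needed). For parameters $a,b$ and a complex variable $\bar x$ let $$\tilde Q_n(\bar x;a,b,N|q)=\frac{(aq;q)_n\,(q^{-N};q)_n}{(abq^{n+1};q)_n}\;{}_3\phi_2\!\left(\begin{matrix}q^{-n},\ abq^{n+1},\ \bar x\\ aq,\ q^{-N}\end{matrix}\,;\,q;q\right) =\frac{(aq;q)_n\,(q^{-N};q)_n}{(abq^{n+1};q)_n}\sum_{m=0}^{n}\frac{(q^{-n};q)_m\,(abq^{n+1};q)_m\,(\bar x;q)_m}{(aq;q)_m\,(q^{-N};q)_m\,(q;q)_m}\,q^m$$ be the $q$-Hahn polynomial, where $(c;q)_m=\prod_{j=0}^{m-1}(1-cq^j)$. Then $\tilde Q_n\big(\bar x;\tfrac{\alpha}{q},\tfrac{\beta}{q},N|q\big)$ is a monic polynomial of degree $n$ in $\bar x$, and all its $n$ zeros in $\mathbb C$ are real and distinct (hence simple).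 If $n\ge 2$ and $z_{n,1}<z_{n,2}<\dots<z_{n,n}$ are these zeros, then $$z_{n,1}<1\qquad\text{and}\qquad q^{-N}<z_{n,n}.$$ -/

import Mathlib

/-- The `q`-Pochhammer symbol `(a; q)_m = ∏_{j < m} (1 - a q^j)`. -/
noncomputable def qPochhammer (a q : ℂ) (m : ℕ) : ℂ :=
  ∏ j ∈ Finset.range m, (1 - a * q ^ j)

/-- The multi-parameter symbol `(a₁, …, a_r; q)_m = (a₁; q)_m ⋯ (a_r; q)_m`. -/
noncomputable def qPochhammerList (as : List ℂ) (q : ℂ) (m : ℕ) : ℂ :=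
  (as.map fun a => qPochhammer a q m).prod

/-- The basic hypergeometric series `_rφ_s(a₁, …, a_r; b₁, …, b_s; q, z)`.
If `q^{-n}` is an upper parameter, all terms with `m > n` vanish and the sum is finite.  This
includes the terms in which a lower parameter `q^{-N}`, `N ≥ n`, produces a quotient `0 / 0`: these
have `m > N`, lie beyond the point of termination, and are `0` here, as usual. -/
noncomputable def basicHypergeometric (as bs : List ℂ) (q z : ℂ) : ℂ :=
  ∑' m : ℕ, qPochhammerList as q m / qPochhammerList bs q m
    * ((-1) ^ m * q ^ (m.choose 2)) ^ (1 + (bs.length : ℤ) - (as.length : ℤ))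
    * (z ^ m / qPochhammer q q m)

/-- The monic `q`-Hahn polynomial `Q̃_n(x; α, β, N | q)`, as a function of the complex variable
`x` (the variable written `q^{-x}` on the lattice). -/
noncomputable def qHahn (q α β : ℂ) (N n : ℕ) (x : ℂ) : ℂ :=
  qPochhammer (α * q) q n * qPochhammer (q ^ (-(N : ℤ))) q n
      / qPochhammer (α * β * q * q ^ n) q n
    * basicHypergeometric [q ^ (-(n : ℤ)), α * β * q ^ (n + 1), x] [α * q, q ^ (-(N : ℤ))] q q

/-!
The monic `q`-Hahn polynomial `P` is orthogonal to all polynomials of lower degree for a discrete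
weight on the points `1, q⁻¹, …, q⁻ᴺ`; this follows from two `q`-Chu–Vandermonde sums.  For
`1 < α, β < q⁻¹` the two end masses have the sign opposite to all the others, so the weight is not
positive, but orthogonality against multiples of `(x - 1) (q⁻ᴺ - x)` involves only the inner points
and a weight positive there.  This gives `n - 2` zeros in `(1, q⁻ᴺ)`.  The values of `P` at `1` and
at `q⁻ᴺ` are explicit products, and their signs force one more zero on each side.
-/

open Finset Polynomial

/-- The `q`-analogue `(a - b) (a - b q) ⋯ (a - b q ^ (n - 1))` of `(a - b) ^ n`.  Keeping it
homogeneous in `a` and `b` covers `(a; q)_n`, which is `qSubPow 1 a q n`, and makes sense of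
changing the base from `q` to `q⁻¹`. -/
def qSubPow {R : Type*} [CommRing R] (a b q : R) (n : ℕ) : R :=
  ∏ j ∈ range n, (a - b * q ^ j)

section CommRing

variable {R : Type*} [CommRing R]

@[simp]
theorem qSubPow_zero (a b q : R) : qSubPow a b q 0 = 1 := prod_range_zero _

theorem qSubPow_succ (a b q : R) (n : ℕ) :
    qSubPow a b q (n + 1) = qSubPow a b q n * (a - b * q ^ n) :=
  prod_range_succ _ _

theorem qSubPow_succ' (a b q : R) (n : ℕ) :
    qSubPow a b q (n + 1) = (a - b) * qSubPow a (b * q) q n := by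
  simp only [qSubPow, prod_range_succ', pow_zero, mul_one, pow_succ', mul_assoc, mul_comm (a - b)]

theorem qSubPow_add (a b q : R) (m n : ℕ) :
    qSubPow a b q (m + n) = qSubPow a b q m * qSubPow a (b * q ^ m) q n := by
  simp only [qSubPow, prod_range_add, pow_add, mul_assoc]

theorem qSubPow_mul_mul (c a b q : R) (n : ℕ) :
    qSubPow (c * a) (c * b) q n = c ^ n * qSubPow a b q n := by
  simp only [qSubPow, mul_assoc, ← mul_sub, prod_mul_distrib, prod_const, card_range]

theorem qSubPow_eq_zero {a b q : R} {n j : ℕ} (hj : j < n) (h : a = b * q ^ j) :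
    qSubPow a b q n = 0 :=
  prod_eq_zero (mem_range.2 hj) (sub_eq_zero.2 h)

theorem map_qSubPow {S : Type*} [CommRing S] (f : R →+* S) (a b q : R) (n : ℕ) :
    f (qSubPow a b q n) = qSubPow (f a) (f b) (f q) n := by
  simp only [qSubPow, map_prod, map_sub, map_mul, map_pow]

theorem eval_qSubPow (a b r : R[X]) (x : R) (n : ℕ) :
    (qSubPow a b r n).eval x = qSubPow (a.eval x) (b.eval x) (r.eval x) n :=
  map_qSubPow (evalRingHom x) a b r n

theorem natDegree_sub_mul_C_pow_le {a b : R[X]} (ha : a.natDegree ≤ 1) (hb : b.natDegree ≤ 1)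
    (q : R) (j : ℕ) : (a - b * C q ^ j).natDegree ≤ 1 := by
  rw [← C_pow]
  exact natDegree_sub_le_of_le ha ((natDegree_mul_C_le _ _).trans hb)

theorem natDegree_qSubPow_le {a b : R[X]} (ha : a.natDegree ≤ 1) (hb : b.natDegree ≤ 1) (q : R)
    (n : ℕ) : (qSubPow a b (C q) n).natDegree ≤ n :=
  (natDegree_prod_le _ _).trans <|
    (sum_le_card_nsmul (range n) _ 1 fun j _ => natDegree_sub_mul_C_pow_le ha hb q j).trans
      (by simp)

theorem coeff_qSubPow {a b : R[X]} (ha : a.natDegree ≤ 1) (hb : b.natDegree ≤ 1) (q : R) (n : ℕ) :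
    (qSubPow a b (C q) n).coeff n = qSubPow (a.coeff 1) (b.coeff 1) q n := by
  have h := coeff_prod_of_natDegree_le (s := range n) (fun j => a - b * C q ^ j) 1
    fun j _ => natDegree_sub_mul_C_pow_le ha hb q j
  rw [card_range, mul_one] at h
  rw [qSubPow, h]
  exact prod_congr rfl fun j _ => by rw [coeff_sub, ← C_pow, coeff_mul_C]

end CommRing

section Field

variable {K : Type*} [Field K] {q : K}

theorem qSubPow_inv_base (hq0 : q ≠ 0) (a b : K) (n : ℕ) :
    qSubPow a (b * q ^ n * q⁻¹) q⁻¹ n = qSubPow a b q n := by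
  rw [qSubPow, ← prod_range_reflect, qSubPow]
  refine prod_congr rfl fun j hj => ?_
  obtain ⟨i, rfl⟩ := Nat.exists_eq_add_of_lt (mem_range.1 hj)
  rw [show j + i + 1 - 1 - j = i by omega, inv_pow]
  field_simp
  ring

theorem qSubPow_inv_base_mul (hq0 : q ≠ 0) (a b : K) (n : ℕ) :
    qSubPow a b q⁻¹ n * qSubPow 0 1 q n = qSubPow b a q n := by
  simp only [qSubPow, ← prod_mul_distrib]
  refine prod_congr rfl fun j _ => ?_
  rw [inv_pow]
  field_simp
  ring

theorem qSubPow_zero_left_ne_zero (hq0 : q ≠ 0) {b : K} (hb : b ≠ 0) (n : ℕ) :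
    qSubPow 0 b q n ≠ 0 :=
  prod_ne_zero_iff.2 fun j _ => by simp [hb, hq0]

theorem not_isOfFinOrder_inv (hq : ¬IsOfFinOrder q) : ¬IsOfFinOrder q⁻¹ := by
  simpa only [isOfFinOrder_iff_pow_eq_one, inv_pow, inv_eq_one] using hq

theorem one_sub_pow_succ_ne_zero (hq : ¬IsOfFinOrder q) (n : ℕ) : 1 - q ^ (n + 1) ≠ 0 :=
  fun h => hq (isOfFinOrder_iff_pow_eq_one.2 ⟨n + 1, n.succ_pos, (sub_eq_zero.1 h).symm⟩)

theorem qSubPow_one_self_ne_zero (hq : ¬IsOfFinOrder q) (n : ℕ) : qSubPow 1 q q n ≠ 0 :=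
  prod_ne_zero_iff.2 fun j _ => by rw [← pow_succ']; exact one_sub_pow_succ_ne_zero hq j

/-- The `q`-analogue of the divided power `(a - b) ^ n / n!`, up to the factor `(1 - q) ^ n`. -/
def qSubDividedPow (a b q : K) (n : ℕ) : K :=
  qSubPow a b q n / qSubPow 1 q q n

@[simp]
theorem qSubDividedPow_zero (a b q : K) : qSubDividedPow a b q 0 = 1 := by simp [qSubDividedPow]

theorem one_sub_pow_succ_mul_qSubDividedPow (hq : ¬IsOfFinOrder q) (a b : K) (n : ℕ) :
    (1 - q ^ (n + 1)) * qSubDividedPow a b q (n + 1)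
      = (a - b * q ^ n) * qSubDividedPow a b q n := by
  have := one_sub_pow_succ_ne_zero hq n
  have := qSubPow_one_self_ne_zero hq n
  rw [qSubDividedPow, qSubPow_succ, qSubPow_succ, ← pow_succ', qSubDividedPow]
  field_simp

/-- The `q`-Chu–Vandermonde sum, as the binomial theorem for `a - c = (a - b) + (b - c)`. -/
theorem sum_antidiagonal_qSubDividedPow (hq : ¬IsOfFinOrder q) (a b c : K) (n : ℕ) :
    ∑ p ∈ antidiagonal n, qSubDividedPow a b q p.1 * qSubDividedPow b c q p.2
      = qSubDividedPow a c q n := by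
  induction n with
  | zero => simp
  | succ n ih =>
    refine mul_left_cancel₀ (one_sub_pow_succ_ne_zero hq n) ?_
    have split_factor : (1 - q ^ (n + 1)) *
          ∑ p ∈ antidiagonal (n + 1), qSubDividedPow a b q p.1 * qSubDividedPow b c q p.2
        = ∑ p ∈ antidiagonal (n + 1),
            (1 - q ^ p.1) * qSubDividedPow a b q p.1 * qSubDividedPow b c q p.2
          + ∑ p ∈ antidiagonal (n + 1),
            q ^ p.1 * qSubDividedPow a b q p.1 * ((1 - q ^ p.2) * qSubDividedPow b c q p.2) := by
      rw [mul_sum, ← sum_add_distrib]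
      refine sum_congr rfl fun p hp => ?_
      rw [← mem_antidiagonal.1 hp]
      ring
    rw [split_factor, Nat.sum_antidiagonal_succ, Nat.sum_antidiagonal_succ' (n := n),
      one_sub_pow_succ_mul_qSubDividedPow hq, ← ih, mul_sum]
    simp only [pow_zero, sub_self, zero_mul, mul_zero, zero_add,
      one_sub_pow_succ_mul_qSubDividedPow hq, ← sum_add_distrib]
    refine sum_congr rfl fun p hp => ?_
    rw [← mem_antidiagonal.1 hp]
    ring

theorem qSubPow_mul_qSubDividedPow (hq : ¬IsOfFinOrder q) (a b : K) (n : ℕ) :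
    qSubPow 1 q q n * qSubDividedPow a b q n = qSubPow a b q n :=
  mul_div_cancel₀ _ (qSubPow_one_self_ne_zero hq n)

theorem qSubDividedPow_inv_base (hq0 : q ≠ 0) (a b : K) (m l : ℕ) :
    qSubDividedPow a (b * q ^ (m + l) * q⁻¹) q⁻¹ l
      = qSubPow a (b * q ^ m) q l / qSubPow 1 q⁻¹ q⁻¹ l := by
  rw [qSubDividedPow, pow_add, ← mul_assoc b, qSubPow_inv_base hq0]

theorem qSubDividedPow_inv_base_swap (hq0 : q ≠ 0) (hq : ¬IsOfFinOrder q) (a b : K) (n : ℕ) :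
    qSubDividedPow a b q⁻¹ n = q ^ n * qSubDividedPow b a q n := by
  have hfactorial : q ^ n * (qSubPow 1 q⁻¹ q⁻¹ n * qSubPow 0 1 q n) = qSubPow 1 q q n := by
    rw [qSubPow_inv_base_mul hq0, ← qSubPow_mul_mul, mul_inv_cancel₀ hq0, mul_one]
  rw [qSubDividedPow, qSubDividedPow, mul_div_assoc',
    div_eq_div_iff (qSubPow_one_self_ne_zero (not_isOfFinOrder_inv hq) n)
      (qSubPow_one_self_ne_zero hq n), ← hfactorial, ← qSubPow_inv_base_mul hq0 a b]
  ring

theorem qSubPow_inv_pow (hq0 : q ≠ 0) (m l : ℕ) :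
    qSubPow 1 (q⁻¹ ^ (m + l)) q m = qSubPow 1 (q⁻¹ ^ (l + 1)) q⁻¹ m := by
  rw [← qSubPow_inv_base hq0]
  congr 1
  simp only [inv_pow]
  field_simp
  ring

/-- The factor `(q⁻ⁱ; q)_m` lowers the index `i = m + l` of a divided power to `l`. -/
theorem qSubPow_inv_pow_mul_div (hq0 : q ≠ 0) (hq : ¬IsOfFinOrder q) (c : K) (m l : ℕ) :
    qSubPow 1 (q⁻¹ ^ (m + l)) q m * (qSubPow 1 (c * q ^ m) q l / qSubPow 1 q q (m + l))
      = q⁻¹ ^ m / qSubPow 0 1 q m * qSubDividedPow (q⁻¹ ^ m) c q l := by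
  have lower : qSubPow 1 (q⁻¹ ^ (m + l)) q m * qSubPow 0 1 q m
      = (q⁻¹ ^ (l + 1)) ^ m * qSubPow 1 (q * q ^ l) q m := by
    rw [qSubPow_inv_pow hq0, qSubPow_inv_base_mul hq0, ← qSubPow_mul_mul, mul_one, ← pow_succ',
      ← mul_pow, inv_mul_cancel₀ hq0, one_pow]
  have rescale : qSubPow (q⁻¹ ^ m) c q l = (q⁻¹ ^ m) ^ l * qSubPow 1 (c * q ^ m) q l := by
    rw [← qSubPow_mul_mul, mul_one, mul_left_comm, ← mul_pow, inv_mul_cancel₀ hq0, one_pow, mul_one]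
  have hsplit := qSubPow_add 1 q q l m
  have hne := qSubPow_one_self_ne_zero hq (l + m)
  rw [add_comm m l, qSubDividedPow, rescale, div_mul_div_comm, mul_div_assoc',
    div_eq_div_iff hne (mul_ne_zero (qSubPow_zero_left_ne_zero hq0 one_ne_zero m)
      (qSubPow_one_self_ne_zero hq l)), hsplit]
  rw [add_comm m l] at lower
  linear_combination qSubPow 1 (c * q ^ m) q l * qSubPow 1 q q l * lower

/-! ### The `q`-Hahn polynomials -/

/-- The monic `q`-Hahn polynomial `Q̃_n(x; α / q, β / q, N | q)`.  Here `α β q ^ n q⁻¹` is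
`a b q ^ (n + 1)` for `a = α / q` and `b = β / q`, and the coefficients of the `₃φ₂` series are
written as divided powers in base `q⁻¹`, a form in which they can be summed directly. -/
noncomputable def qHahnPoly (q α β : K) (N n : ℕ) : K[X] :=
  C (qSubPow 1 (q⁻¹ ^ N) q n * qSubPow 1 q⁻¹ q⁻¹ n / qSubPow 1 (α * β * q ^ n * q⁻¹) q n) *
    ∑ p ∈ antidiagonal n,
      C (qSubDividedPow (α * β * q ^ n * q⁻¹) 1 q⁻¹ p.1 *
          qSubDividedPow 1 (α * q ^ n * q⁻¹) q⁻¹ p.2 / qSubPow 1 (q⁻¹ ^ N) q p.1) *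
        qSubPow 1 X (C q) p.1

theorem map_qHahnPoly {L : Type*} [Field L] (f : K →+* L) (q α β : K) (N n : ℕ) :
    (qHahnPoly q α β N n).map f = qHahnPoly (f q) (f α) (f β) N n := by
  have hmap (m : ℕ) : (qSubPow 1 X (C q) m).map f = qSubPow 1 X (C (f q)) m := by
    rw [← coe_mapRingHom, map_qSubPow]
    simp
  simp [qHahnPoly, qSubDividedPow, Polynomial.map_sum, hmap, map_qSubPow, map_one]

theorem eval_qHahnPoly (q α β : K) (N n : ℕ) (x : K) :
    (qHahnPoly q α β N n).eval x =
      qSubPow 1 (q⁻¹ ^ N) q n * qSubPow 1 q⁻¹ q⁻¹ n / qSubPow 1 (α * β * q ^ n * q⁻¹) q n *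
        ∑ p ∈ antidiagonal n, qSubDividedPow (α * β * q ^ n * q⁻¹) 1 q⁻¹ p.1 *
          qSubDividedPow 1 (α * q ^ n * q⁻¹) q⁻¹ p.2 / qSubPow 1 (q⁻¹ ^ N) q p.1 *
            qSubPow 1 x q p.1 := by
  simp only [qHahnPoly, eval_mul, eval_C, eval_finsetSum, eval_qSubPow, eval_one, eval_X]

theorem natDegree_qHahnPoly_le (q α β : K) (N n : ℕ) : (qHahnPoly q α β N n).natDegree ≤ n :=
  (natDegree_C_mul_le _ _).trans <| natDegree_sum_le_of_forall_le _ _ fun _ hp =>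
    (natDegree_C_mul_le _ _).trans <|
      (natDegree_qSubPow_le (by simp) natDegree_X_le q _).trans
        (HasAntidiagonal.antidiagonal.fst_le hp)

theorem coeff_qHahnPoly (hq0 : q ≠ 0) (hq : ¬IsOfFinOrder q) {α β : K} {N n : ℕ}
    (hN : qSubPow 1 (q⁻¹ ^ N) q n ≠ 0) (hB : qSubPow 1 (α * β * q ^ n * q⁻¹) q n ≠ 0) :
    (qHahnPoly q α β N n).coeff n = 1 := by
  have lower_terms : ∀ p ∈ antidiagonal n, p ≠ (n, 0) →
      (qSubPow 1 X (C q) p.1).coeff n = 0 := fun p hp hpn => by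
    refine coeff_eq_zero_of_natDegree_lt <|
      (natDegree_qSubPow_le (by simp) natDegree_X_le q _).trans_lt ?_
    refine (HasAntidiagonal.antidiagonal.fst_le hp).lt_of_ne fun h => hpn ?_
    have := mem_antidiagonal.1 hp
    exact Prod.ext h (by omega)
  have top_term := qSubPow_mul_qSubDividedPow (not_isOfFinOrder_inv hq)
    (α * β * q ^ n * q⁻¹) 1 n
  have lead := qSubPow_inv_base_mul hq0 (α * β * q ^ n * q⁻¹) 1 n
  rw [qHahnPoly, coeff_C_mul, finsetSum_coeff, sum_eq_single (n, 0)]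
  · rw [coeff_C_mul, coeff_qSubPow (by simp) natDegree_X_le, coeff_one, if_neg one_ne_zero,
      coeff_X_one, qSubDividedPow_zero, mul_one]
    rw [← top_term] at lead
    rw [div_mul_eq_mul_div _ (qSubPow 1 (q⁻¹ ^ N) q n), div_mul_div_comm,
      div_eq_one_iff_eq (mul_ne_zero hB hN), ← lead]
    ring
  · intro p hp hpn
    rw [coeff_C_mul, lower_terms p hp hpn, mul_zero]
  · simp

theorem monic_qHahnPoly (hq0 : q ≠ 0) (hq : ¬IsOfFinOrder q) {α β : K} {N n : ℕ}
    (hN : qSubPow 1 (q⁻¹ ^ N) q n ≠ 0) (hB : qSubPow 1 (α * β * q ^ n * q⁻¹) q n ≠ 0) :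
    (qHahnPoly q α β N n).Monic :=
  monic_of_natDegree_le_of_coeff_eq_one n (natDegree_qHahnPoly_le ..) (coeff_qHahnPoly hq0 hq hN hB)

theorem natDegree_qHahnPoly (hq0 : q ≠ 0) (hq : ¬IsOfFinOrder q) {α β : K} {N n : ℕ}
    (hN : qSubPow 1 (q⁻¹ ^ N) q n ≠ 0) (hB : qSubPow 1 (α * β * q ^ n * q⁻¹) q n ≠ 0) :
    (qHahnPoly q α β N n).natDegree = n :=
  natDegree_eq_of_le_of_coeff_ne_zero (natDegree_qHahnPoly_le ..)
    ((coeff_qHahnPoly hq0 hq hN hB).trans_ne one_ne_zero)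

theorem eval_one_qHahnPoly (hq0 : q ≠ 0) (hq : ¬IsOfFinOrder q) (α β : K) (N n : ℕ) :
    (qHahnPoly q α β N n).eval 1 =
      qSubPow 1 (q⁻¹ ^ N) q n / qSubPow 1 (α * β * q ^ n * q⁻¹) q n * qSubPow 1 α q n := by
  rw [eval_qHahnPoly, sum_eq_single (0, n)]
  · rw [qSubDividedPow_zero, one_mul, qSubPow_zero, qSubPow_zero, div_one, mul_one,
      mul_div_right_comm, mul_assoc, qSubPow_mul_qSubDividedPow (not_isOfFinOrder_inv hq),
      qSubPow_inv_base hq0]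
  · intro p hp hp0
    have hpos : 0 < p.1 := Nat.pos_of_ne_zero fun h => hp0 <| by
      have := mem_antidiagonal.1 hp
      exact Prod.ext h (by omega)
    rw [(qSubPow_eq_zero hpos (by simp) : qSubPow 1 1 q p.1 = 0), mul_zero]
  · simp

/-- At `x = q⁻ᴺ` the series loses the factors `(q⁻ᴺ; q)_m` and becomes a `q`-Chu–Vandermonde sum. -/
theorem mul_eval_inv_pow_qHahnPoly (hq0 : q ≠ 0) (hq : ¬IsOfFinOrder q) (α β : K) {N n : ℕ}
    (hN : ∀ m ≤ n, qSubPow 1 (q⁻¹ ^ N) q m ≠ 0) :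
    qSubPow 0 1 q n * (qHahnPoly q α β N n).eval (q⁻¹ ^ N) =
      qSubPow 1 (q⁻¹ ^ N) q n / qSubPow 1 (α * β * q ^ n * q⁻¹) q n *
        ((α * q ^ n * q⁻¹) ^ n * qSubPow 1 β q n) := by
  have hq' : ¬IsOfFinOrder q⁻¹ := not_isOfFinOrder_inv hq
  have hsum := sum_antidiagonal_qSubDividedPow hq' (α * β * q ^ n * q⁻¹) 1 (α * q ^ n * q⁻¹) n
  have hend : qSubPow (α * β * q ^ n * q⁻¹) (α * q ^ n * q⁻¹) q⁻¹ n * qSubPow 0 1 q n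
      = (α * q ^ n * q⁻¹) ^ n * qSubPow 1 β q n := by
    rw [qSubPow_inv_base_mul hq0, ← qSubPow_mul_mul]
    congr 1 <;> ring
  have hcancel (p : ℕ × ℕ) (hp : p ∈ antidiagonal n) : qSubPow 1 (q⁻¹ ^ N) q p.1 ≠ 0 :=
    hN _ (HasAntidiagonal.antidiagonal.fst_le hp)
  rw [eval_qHahnPoly, sum_congr rfl fun p hp => div_mul_cancel₀ _ (hcancel p hp), hsum, ← hend,
    ← qSubPow_mul_qSubDividedPow hq' _ (α * q ^ n * q⁻¹)]
  ring

theorem qHahn_eq_eval_qHahnPoly {q : ℂ} (hq0 : q ≠ 0) (hq : ¬IsOfFinOrder q) {α : ℂ} (β : ℂ)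
    (N : ℕ) {n : ℕ} (hα : qSubPow 1 α q n ≠ 0) (x : ℂ) :
    qHahn q (α / q) (β / q) N n x = (qHahnPoly q α β N n).eval x := by
  have qPochhammer_eq (a : ℂ) (m : ℕ) : qPochhammer a q m = qSubPow 1 a q m := rfl
  have hB : α / q * (β / q) * q ^ (n + 1) = α * β * q ^ n * q⁻¹ := by
    field_simp
    ring
  have hB' : α / q * (β / q) * q * q ^ n = α * β * q ^ n * q⁻¹ := by field_simp
  rw [qHahn, basicHypergeometric, eval_qHahnPoly, tsum_eq_sum (s := range (n + 1)),
    Nat.sum_antidiagonal_eq_sum_range_succ_mk, mul_sum, mul_sum]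
  · refine sum_congr rfl fun m hm => ?_
    obtain ⟨l, rfl⟩ := Nat.exists_eq_add_of_le (Nat.lt_succ_iff.1 (mem_range.1 hm))
    rw [qSubPow_add] at hα
    have hαm := left_ne_zero_of_mul hα
    have hqm := qSubPow_one_self_ne_zero hq m
    have hql := qSubPow_one_self_ne_zero (not_isOfFinOrder_inv hq) l
    have hfactorial : qSubPow 1 q⁻¹ q⁻¹ (m + l)
        = qSubPow 1 q⁻¹ q⁻¹ l * qSubPow 1 (q⁻¹ ^ (m + l)) q m := by
      rw [qSubPow_inv_pow hq0, pow_succ', ← qSubPow_add, add_comm]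
    simp only [qPochhammerList, qPochhammer_eq, List.map_cons, List.map_nil, List.prod_cons,
      List.prod_nil, List.length_cons, List.length_nil, zpow_neg, zpow_natCast, hB, hB',
      ← inv_pow, div_mul_cancel₀ _ hq0, Nat.add_sub_cancel_left]
    rw [qSubDividedPow_inv_base_swap hq0 hq, qSubDividedPow_inv_base hq0, hfactorial,
      qSubPow_add 1 α, qSubDividedPow]
    simp only [Nat.cast_add, Nat.cast_one, zero_add, mul_one,
      show (1 + (1 + 1) - (1 + 1 + 1) : ℤ) = 0 by norm_num, zpow_zero]
    generalize qSubPow 1 q⁻¹ q⁻¹ l = v at hql ⊢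
    field_simp
  · intro m hm
    have terminates : qSubPow 1 (q⁻¹ ^ n) q m = 0 :=
      qSubPow_eq_zero (by simpa [Nat.lt_succ_iff] using hm : n < m) (by simp [hq0])
    simp [qPochhammerList, qPochhammer_eq, terminates, ← inv_pow]

/-! ### Orthogonality -/

/-- The `q`-Hahn weight at the lattice point `x = q⁻ⁱ`, where `i + j = N`.  It equals
`(α; q)_i (β; q)_j α ^ j / ((q; q)_i (q; q)_j)`. -/
def qHahnWeight (q α β : K) (i j : ℕ) : K :=
  qSubDividedPow 1 α q i * qSubDividedPow α (α * β) q j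

theorem qHahnWeight_mul_qSubPow_mul_qSubPow (hq0 : q ≠ 0) (hq : ¬IsOfFinOrder q) (α β : K)
    (m l j k : ℕ) :
    qHahnWeight q α β (m + l) j * qSubPow 1 (q⁻¹ ^ (m + l)) q m * qSubPow 1 (β * q ^ j) q k
      = q⁻¹ ^ m / qSubPow 0 1 q m * qSubPow 1 α q m * qSubPow 1 β q k *
        (qSubDividedPow (q⁻¹ ^ m) α q l * qSubDividedPow α (α * β * q ^ k) q j) := by
  have lower := qSubPow_inv_pow_mul_div hq0 hq α m l
  have hα : qSubDividedPow 1 α q (m + l)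
      = qSubPow 1 α q m * (qSubPow 1 (α * q ^ m) q l / qSubPow 1 q q (m + l)) := by
    rw [qSubDividedPow, qSubPow_add, mul_div_assoc]
  have hβ : qSubDividedPow α (α * β) q j * qSubPow 1 (β * q ^ j) q k
      = qSubPow 1 β q k * qSubDividedPow α (α * β * q ^ k) q j := by
    have pull (b : K) : qSubPow α (α * b) q j = α ^ j * qSubPow 1 b q j := by
      rw [← qSubPow_mul_mul, mul_one]
    have swap : qSubPow 1 β q j * qSubPow 1 (β * q ^ j) q k
        = qSubPow 1 β q k * qSubPow 1 (β * q ^ k) q j := by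
      rw [← qSubPow_add, ← qSubPow_add, add_comm]
    rw [qSubDividedPow, qSubDividedPow, mul_assoc α, pull, pull]
    linear_combination α ^ j / qSubPow 1 q q j * swap
  rw [qHahnWeight, hα]
  linear_combination qSubPow 1 α q m * qSubDividedPow α (α * β) q j *
    qSubPow 1 (β * q ^ j) q k * lower + q⁻¹ ^ m / qSubPow 0 1 q m * qSubPow 1 α q m *
      qSubDividedPow (q⁻¹ ^ m) α q l * hβ

theorem sum_antidiagonal_add_of_eq_zero {M : Type*} [AddCommMonoid M] {f : ℕ × ℕ → M} {m : ℕ}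
    (hf : ∀ p, p.1 < m → f p = 0) (n : ℕ) :
    ∑ p ∈ antidiagonal (m + n), f p = ∑ p ∈ antidiagonal n, f (m + p.1, p.2) := by
  induction m generalizing f with
  | zero => simp
  | succ m ih =>
    rw [add_right_comm, Nat.sum_antidiagonal_succ, hf _ m.succ_pos, zero_add,
      ih (f := fun p => f (p.1 + 1, p.2)) fun p hp => hf _ (Nat.succ_lt_succ hp)]
    simp only [add_right_comm]

theorem sum_qHahnWeight_mul_qSubPow_mul_qSubPow (hq0 : q ≠ 0) (hq : ¬IsOfFinOrder q) (α β : K)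
    (m M k : ℕ) :
    ∑ p ∈ antidiagonal (m + M), qHahnWeight q α β p.1 p.2 * qSubPow 1 (q⁻¹ ^ p.1) q m *
        qSubPow 1 (β * q ^ p.2) q k
      = qSubPow 1 α q m * qSubPow 1 β q k * (qSubPow 1 (q⁻¹ ^ (m + M)) q m *
        (qSubPow 1 (α * β * q ^ k * q ^ m) q M / qSubPow 1 q q (m + M))) := by
  rw [sum_antidiagonal_add_of_eq_zero, qSubPow_inv_pow_mul_div hq0 hq,
    ← sum_antidiagonal_qSubDividedPow hq _ α, mul_sum, mul_sum]
  · refine sum_congr rfl fun p _ => ?_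
    rw [qHahnWeight_mul_qSubPow_mul_qSubPow hq0 hq]
    ring
  · intro p hp
    rw [qSubPow_eq_zero hp (by simp [hq0]), mul_zero, zero_mul]

theorem qSubDividedPow_div_mul_sum_qHahnWeight (hq0 : q ≠ 0) (hq : ¬IsOfFinOrder q) (α β : K)
    {m l d : ℕ} (hm : qSubPow 1 (q⁻¹ ^ (m + l + d)) q m ≠ 0) (k : ℕ) :
    qSubDividedPow 1 (α * q ^ (m + l) * q⁻¹) q⁻¹ l / qSubPow 1 (q⁻¹ ^ (m + l + d)) q m *
        ∑ p ∈ antidiagonal (m + l + d), qHahnWeight q α β p.1 p.2 * qSubPow 1 (q⁻¹ ^ p.1) q m *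
          qSubPow 1 (β * q ^ p.2) q k
      = qSubPow 1 α q (m + l) * qSubPow 1 β q k * qSubPow 1 (α * β * q ^ k * q ^ (m + l)) q d /
        qSubPow 1 q q (m + l + d) *
          qSubDividedPow 1 (α * β * q ^ k * q ^ (m + l) * q⁻¹) q⁻¹ l := by
  rw [add_assoc m l d] at hm ⊢
  rw [sum_qHahnWeight_mul_qSubPow_mul_qSubPow hq0 hq, qSubDividedPow_inv_base hq0,
    qSubDividedPow_inv_base hq0, qSubPow_add 1 α, qSubPow_add 1 _ q l d, mul_assoc (α * β * q ^ k),
    ← pow_add]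
  generalize qSubPow 1 (q⁻¹ ^ (m + (l + d))) q m = u at *
  field_simp

theorem sum_qHahnWeight_mul_eval_qHahnPoly_mul_qSubPow (hq0 : q ≠ 0) (hq : ¬IsOfFinOrder q)
    (α β : K) {N n k : ℕ} (hn : n ≤ N) (hN : ∀ m ≤ n, qSubPow 1 (q⁻¹ ^ N) q m ≠ 0) (hk : k < n) :
    ∑ p ∈ antidiagonal N, qHahnWeight q α β p.1 p.2 * (qHahnPoly q α β N n).eval (q⁻¹ ^ p.1) *
      qSubPow 1 (β * q ^ p.2) q k = 0 := by
  obtain ⟨d, rfl⟩ := Nat.exists_eq_add_of_le hn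
  set B := α * β * q ^ n * q⁻¹ with hB
  set c := α * β * q ^ k with hc
  have vanish : ∑ r ∈ antidiagonal n,
      qSubDividedPow B 1 q⁻¹ r.1 * qSubDividedPow 1 (c * q ^ n * q⁻¹) q⁻¹ r.2 = 0 := by
    rw [sum_antidiagonal_qSubDividedPow (not_isOfFinOrder_inv hq), qSubDividedPow,
      qSubPow_eq_zero hk, zero_div]
    rw [hB, hc, inv_pow]
    field_simp
  calc _ = qSubPow 1 (q⁻¹ ^ (n + d)) q n * qSubPow 1 q⁻¹ q⁻¹ n / qSubPow 1 B q n *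
        ∑ r ∈ antidiagonal n, qSubDividedPow B 1 q⁻¹ r.1 *
          (qSubDividedPow 1 (α * q ^ n * q⁻¹) q⁻¹ r.2 / qSubPow 1 (q⁻¹ ^ (n + d)) q r.1 *
            ∑ p ∈ antidiagonal (n + d), qHahnWeight q α β p.1 p.2 *
              qSubPow 1 (q⁻¹ ^ p.1) q r.1 * qSubPow 1 (β * q ^ p.2) q k) := by
        simp only [eval_qHahnPoly, mul_sum, sum_mul]
        rw [sum_comm]
        exact sum_congr rfl fun r _ => sum_congr rfl fun p _ => by ring
    _ = qSubPow 1 (q⁻¹ ^ (n + d)) q n * qSubPow 1 q⁻¹ q⁻¹ n / qSubPow 1 B q n *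
        ∑ r ∈ antidiagonal n, qSubPow 1 α q n * qSubPow 1 β q k * qSubPow 1 (c * q ^ n) q d /
          qSubPow 1 q q (n + d) *
            (qSubDividedPow B 1 q⁻¹ r.1 * qSubDividedPow 1 (c * q ^ n * q⁻¹) q⁻¹ r.2) := by
        refine congrArg _ (sum_congr rfl ?_)
        rintro ⟨m, l⟩ hr
        obtain rfl := mem_antidiagonal.1 hr
        rw [qSubDividedPow_div_mul_sum_qHahnWeight hq0 hq α β (hN m (Nat.le_add_right m l)),
          mul_left_comm]
    _ = 0 := by rw [← mul_sum, vanish, mul_zero, mul_zero]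

theorem degree_qSubPow_C_mul_X {c : K} (hc : c ≠ 0) (hq0 : q ≠ 0) (n : ℕ) :
    (qSubPow 1 (C c * X) (C q) n).degree = n := by
  have hX : (C c * X).natDegree ≤ 1 := (natDegree_C_mul_le c X).trans natDegree_X_le
  refine degree_eq_of_le_of_coeff_ne_zero
    (degree_le_of_natDegree_le (natDegree_qSubPow_le (by simp) hX q n)) ?_
  rw [coeff_qSubPow (by simp) hX, coeff_one, if_neg one_ne_zero, coeff_C_mul, coeff_X_one, mul_one]
  exact qSubPow_zero_left_ne_zero hq0 hc n

theorem sum_qHahnWeight_mul_eval_qHahnPoly_mul_eval (hq0 : q ≠ 0) (hq : ¬IsOfFinOrder q)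
    (α : K) {β : K} (hβ : β ≠ 0) {N n : ℕ} (hn : n ≤ N)
    (hN : ∀ m ≤ n, qSubPow 1 (q⁻¹ ^ N) q m ≠ 0) {r : K[X]} (hr : r.degree < n) :
    ∑ p ∈ antidiagonal N, qHahnWeight q α β p.1 p.2 * (qHahnPoly q α β N n).eval (q⁻¹ ^ p.1) *
      r.eval (q⁻¹ ^ p.1) = 0 := by
  have hc : β * q ^ N ≠ 0 := mul_ne_zero hβ (pow_ne_zero N hq0)
  let S : Polynomial.Sequence K :=
    ⟨fun k => qSubPow 1 (C (β * q ^ N) * X) (C q) k, degree_qSubPow_C_mul_X hc hq0⟩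
  have hspan : r ∈ Submodule.span K (S '' Set.Iio n) := by
    rw [S.span_degreeLT fun i _ => (leadingCoeff_ne_zero.2 (S.ne_zero i)).isUnit]
    exact mem_degreeLT.2 hr
  clear hr
  induction hspan using Submodule.span_induction with
  | mem r h =>
    obtain ⟨k, hk, rfl⟩ := h
    rw [← sum_qHahnWeight_mul_eval_qHahnPoly_mul_qSubPow hq0 hq α β hn hN hk]
    refine sum_congr rfl fun p hp => congrArg _ ?_
    change (qSubPow 1 (C (β * q ^ N) * X) (C q) k).eval _ = _
    simp only [eval_qSubPow, eval_one, eval_mul, eval_C, eval_X]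
    rw [← mem_antidiagonal.1 hp, pow_add, inv_pow]
    congr 1
    field_simp
  | zero => simp
  | add x y _ _ hx hy => simp only [eval_add, mul_add, sum_add_distrib, hx, hy, add_zero]
  | smul a x _ hx =>
    simp only [eval_smul, smul_eq_mul, mul_left_comm _ a, ← mul_sum, hx, mul_zero]

/-- The factor `(x - 1) (q⁻ᴺ - x)` removes the two end masses, whose sign is opposite to that of
the others when `1 < α, β < q⁻¹`. -/
theorem sum_Ioo_qHahnWeight_mul_eval_qHahnPoly_mul_eval (hq0 : q ≠ 0) (hq : ¬IsOfFinOrder q)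
    (α : K) {β : K} (hβ : β ≠ 0) {N n : ℕ} (hn : n ≤ N)
    (hN : ∀ m ≤ n, qSubPow 1 (q⁻¹ ^ N) q m ≠ 0) {d : ℕ} (hd : d + 2 ≤ n) {r : K[X]}
    (hr : r.degree < d) :
    ∑ i ∈ Ioo 0 N, (q⁻¹ ^ i - 1) * (q⁻¹ ^ N - q⁻¹ ^ i) * qHahnWeight q α β i (N - i) *
      (qHahnPoly q α β N n).eval (q⁻¹ ^ i) * r.eval (q⁻¹ ^ i) = 0 := by
  have hdeg : ((X - 1) * (C (q⁻¹ ^ N) - X) * r).degree < (n : WithBot ℕ) := by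
    have hquad : ((X - 1) * (C (q⁻¹ ^ N) - X) : K[X]).degree ≤ 2 := by compute_degree
    refine (degree_mul_le _ _).trans_lt ((add_le_add_left hquad _).trans_lt ?_)
    exact (WithBot.add_lt_add_left (by decide) hr).trans_le (by exact_mod_cast add_comm d 2 ▸ hd)
  rw [← sum_qHahnWeight_mul_eval_qHahnPoly_mul_eval hq0 hq α hβ hn hN hdeg,
    Nat.sum_antidiagonal_eq_sum_range_succ_mk]
  refine (sum_congr rfl fun i _ => ?_).trans (sum_subset (fun i hi => ?_) fun i hi hi' => ?_)
  · simp only [eval_mul, eval_sub, eval_X, eval_C, eval_one]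
    ring
  · exact mem_range.2 ((mem_Ioo.1 hi).2.trans N.lt_succ_self)
  · have hend : i = 0 ∨ i = N := by
      rw [mem_range] at hi
      rw [mem_Ioo] at hi'
      omega
    rcases hend with rfl | rfl <;> simp

end Field

/-! ### Real zeros of orthogonal polynomials -/

section RealRoots

/-- The set `S` consists of the zeros of odd multiplicity in `I`. -/
theorem exists_finset_roots_mul_prod_nonneg_or_nonpos {P : ℝ[X]} (hP : P ≠ 0) {I : Set ℝ}
    (hI : I.OrdConnected) :
    ∃ S : Finset ℝ, (∀ s ∈ S, s ∈ I ∧ P.IsRoot s) ∧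
      ((∀ x ∈ I, 0 ≤ P.eval x * (∏ s ∈ S, (X - C s)).eval x) ∨
        ∀ x ∈ I, P.eval x * (∏ s ∈ S, (X - C s)).eval x ≤ 0) := by
  induction hd : P.natDegree using Nat.strong_induction_on generalizing P with
  | _ d ih =>
    by_cases hroot : ∃ s ∈ I, P.IsRoot s
    · obtain ⟨s, hs, hr⟩ := hroot
      obtain ⟨Q, rfl⟩ := dvd_iff_isRoot.2 hr
      have hQ : Q ≠ 0 := right_ne_zero_of_mul hP
      have hdeg : Q.natDegree < d := by
        rw [← hd, natDegree_mul (X_sub_C_ne_zero s) hQ, natDegree_X_sub_C]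
        omega
      obtain ⟨S, hS, hsign⟩ := ih _ hdeg hQ rfl
      have hroots : ∀ t ∈ S, t ∈ I ∧ ((X - C s) * Q).IsRoot t := fun t ht =>
        ⟨(hS t ht).1, root_mul_left_of_isRoot _ (hS t ht).2⟩
      by_cases hmem : s ∈ S
      · refine ⟨S.erase s, fun t ht => hroots t (mem_of_mem_erase ht), ?_⟩
        simpa only [← eval_mul, mul_comm (X - C s) Q, mul_assoc,
          mul_prod_erase S (fun t => X - C t) hmem] using hsign
      · refine ⟨insert s S, forall_mem_insert _ _ _ |>.2 ⟨⟨hs, hr⟩, hroots⟩, ?_⟩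
        have double_root (x : ℝ) :
            ((X - C s) * Q).eval x * (∏ t ∈ insert s S, (X - C t)).eval x
              = (x - s) ^ 2 * (Q.eval x * (∏ t ∈ S, (X - C t)).eval x) := by
          rw [prod_insert hmem]
          simp only [eval_mul, eval_sub, eval_X, eval_C]
          ring
        simp only [double_root]
        exact hsign.imp (fun h x hx => mul_nonneg (sq_nonneg _) (h x hx))
          fun h x hx => mul_nonpos_of_nonneg_of_nonpos (sq_nonneg _) (h x hx)
    · refine ⟨∅, by simp, ?_⟩
      by_contra! hchange
      simp only [prod_empty, eval_one, mul_one] at hchange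
      obtain ⟨⟨x, hx, hneg⟩, y, hy, hpos⟩ := hchange
      obtain ⟨z, hz, hzero⟩ := hI.isPreconnected.intermediate_value hx hy P.continuousOn
        ⟨hneg.le, hpos.le⟩
      exact hroot ⟨z, hz, hzero⟩

theorem exists_finset_roots_of_orthogonal {ι : Type*} {P : ℝ[X]} (hP : P ≠ 0) {I : Set ℝ}
    (hI : I.OrdConnected) {s : Finset ι} {y w : ι → ℝ} (hy : ∀ i ∈ s, y i ∈ I)
    (hinj : Set.InjOn y s) (hw : ∀ i ∈ s, 0 < w i) {d : ℕ} (hd : d ≤ s.card)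
    (horth : ∀ r : ℝ[X], r.degree < d → ∑ i ∈ s, w i * P.eval (y i) * r.eval (y i) = 0) :
    ∃ S : Finset ℝ, S.card = d ∧ ∀ t ∈ S, t ∈ I ∧ P.IsRoot t := by
  suffices ∃ S : Finset ℝ, d ≤ S.card ∧ ∀ t ∈ S, t ∈ I ∧ P.IsRoot t by
    obtain ⟨S, hcard, hS⟩ := this
    obtain ⟨S', hsub, hcard'⟩ := exists_subset_card_eq hcard
    exact ⟨S', hcard', fun t ht => hS t (hsub ht)⟩
  obtain ⟨S, hS, hsign⟩ := exists_finset_roots_mul_prod_nonneg_or_nonpos hP hI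
  by_cases hcard : d ≤ S.card
  · exact ⟨S, hcard, hS⟩
  have hsum := horth (∏ t ∈ S, (X - C t)) (by
    rw [degree_prod]
    simpa [degree_X_sub_C] using hcard)
  simp only [mul_assoc] at hsum
  have terms_eq_zero : ∀ i ∈ s,
      w i * (P.eval (y i) * (∏ t ∈ S, (X - C t)).eval (y i)) = 0 := by
    rcases hsign with hnonneg | hnonpos
    · exact (sum_eq_zero_iff_of_nonneg fun i hi =>
        mul_nonneg (hw i hi).le (hnonneg _ (hy i hi))).1 hsum
    · exact (sum_eq_zero_iff_of_nonpos fun i hi =>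
        mul_nonpos_of_nonneg_of_nonpos (hw i hi).le (hnonpos _ (hy i hi))).1 hsum
  have hroot : ∀ i ∈ s, P.IsRoot (y i) := fun i hi => by
    rcases mul_eq_zero.1 ((mul_eq_zero.1 (terms_eq_zero i hi)).resolve_left (hw i hi).ne')
      with h | h
    · exact h
    · rw [eval_prod, prod_eq_zero_iff] at h
      obtain ⟨t, ht, h⟩ := h
      rw [eval_sub, eval_X, eval_C, sub_eq_zero] at h
      exact h ▸ (hS t ht).2
  refine ⟨s.image y, by rwa [card_image_of_injOn hinj], forall_mem_image.2 fun i hi => ?_⟩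
  exact ⟨hy i hi, hroot i hi⟩

theorem exists_isRoot_lt_of_neg_one_pow_mul_eval_neg {P : ℝ[X]} (hP : P.Monic) {c : ℝ}
    (hc : (-1) ^ P.natDegree * P.eval c < 0) : ∃ t < c, P.IsRoot t := by
  by_contra! h
  have := zero_le_negOnePow_mul_eval_of_le_roots_of_leadingCoeff_nonneg (P := P) (x := c)
    (fun y hy => le_of_not_gt fun hlt => h y hlt hy) (by simp [hP.leadingCoeff])
  rw [Int.cast_negOnePow_natCast] at this
  exact hc.not_ge this

theorem exists_isRoot_gt_of_eval_neg {P : ℝ[X]} (hP : P.Monic) {c : ℝ} (hc : P.eval c < 0) :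
    ∃ t, c < t ∧ P.IsRoot t := by
  by_contra! h
  exact hc.not_ge <| zero_le_eval_of_roots_le_of_leadingCoeff_nonneg
    (fun y hy => le_of_not_gt fun hlt => h y hlt hy) (by simp [hP.leadingCoeff])

theorem monic_eq_prod_X_sub_C {R : Type*} [CommRing R] [IsDomain R] {P : R[X]} (hP : P.Monic)
    {T : Finset R} (hT : ∀ t ∈ T, P.IsRoot t) (hcard : T.card = P.natDegree) :
    P = ∏ t ∈ T, (X - C t) := by
  have hprod : (∏ t ∈ T, (X - C t)).Monic := monic_prod_X_sub_C id T
  refine eq_of_degree_le_of_eval_finset_eq T ?_ ?_ (by rw [hP, hprod]) fun t ht => ?_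
  · rw [hcard, degree_eq_natDegree hP.ne_zero]
  · rw [degree_eq_natDegree hP.ne_zero, degree_eq_natDegree hprod.ne_zero,
      natDegree_finsetProd_X_sub_C_eq_card, hcard]
  · rw [hT t ht, eval_prod, prod_eq_zero ht (by simp)]

end RealRoots

/-! ### Location of the zeros -/

section Real

variable {q : ℝ}

theorem not_isOfFinOrder_of_pos_of_lt_one (hq0 : 0 < q) (hq1 : q < 1) : ¬IsOfFinOrder q := by
  rw [isOfFinOrder_iff_pow_eq_one]
  rintro ⟨n, hn, h⟩
  exact (pow_lt_one₀ hq0.le hq1 hn.ne').ne h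

theorem qSubPow_one_pos (hq0 : 0 < q) (hq1 : q < 1) {a : ℝ} (ha0 : 0 ≤ a) (ha1 : a < 1) (n : ℕ) :
    0 < qSubPow 1 a q n :=
  prod_pos fun _ _ => sub_pos.2 <|
    (mul_le_of_le_one_right ha0 (pow_le_one₀ hq0.le hq1.le)).trans_lt ha1

theorem qSubPow_one_neg (hq0 : 0 < q) (hq1 : q < 1) {a : ℝ} (ha : 1 < a) (haq : a * q < 1) {n : ℕ}
    (hn : n ≠ 0) : qSubPow 1 a q n < 0 := by
  obtain ⟨k, rfl⟩ := Nat.exists_eq_succ_of_ne_zero hn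
  rw [qSubPow_succ']
  exact mul_neg_of_neg_of_pos (sub_neg.2 ha) (qSubPow_one_pos hq0 hq1 (by positivity) haq k)

theorem neg_one_pow_mul_qSubPow_pos {a b : ℝ} {n : ℕ} (h : ∀ j < n, a < b * q ^ j) :
    0 < (-1) ^ n * qSubPow a b q n := by
  rw [← qSubPow_mul_mul]
  refine prod_pos fun j hj => ?_
  linarith [h j (mem_range.1 hj)]

theorem neg_one_pow_mul_qSubPow_inv_pow_pos (hq0 : 0 < q) (hq1 : q < 1) {N m : ℕ} (hm : m ≤ N) :
    0 < (-1) ^ m * qSubPow 1 (q⁻¹ ^ N) q m := by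
  refine neg_one_pow_mul_qSubPow_pos fun j hj => ?_
  rw [inv_pow, inv_mul_eq_div, one_lt_div (by positivity)]
  exact pow_lt_pow_right_of_lt_one₀ hq0 hq1 (hj.trans_le hm)

theorem qSubPow_inv_pow_ne_zero (hq0 : 0 < q) (hq1 : q < 1) {N m : ℕ} (hm : m ≤ N) :
    qSubPow 1 (q⁻¹ ^ N) q m ≠ 0 :=
  right_ne_zero_of_mul (neg_one_pow_mul_qSubPow_inv_pow_pos hq0 hq1 hm).ne'

variable {α β : ℝ} {N n : ℕ}

theorem qHahnWeight_pos (hq0 : 0 < q) (hq1 : q < 1) (hα : 1 < α) (hαq : α * q < 1) (hβ : 1 < β)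
    (hβq : β * q < 1) {i j : ℕ} (hi : i ≠ 0) (hj : j ≠ 0) : 0 < qHahnWeight q α β i j := by
  have hq (k : ℕ) : 0 < qSubPow 1 q q k := qSubPow_one_pos hq0 hq1 hq0.le hq1 k
  have hscale : qSubPow α (α * β) q j = α ^ j * qSubPow 1 β q j := by
    rw [← qSubPow_mul_mul, mul_one]
  rw [qHahnWeight, qSubDividedPow, qSubDividedPow, hscale]
  refine mul_pos_of_neg_of_neg (div_neg_of_neg_of_pos ?_ (hq i)) (div_neg_of_neg_of_pos ?_ (hq j))
  · exact qSubPow_one_neg hq0 hq1 hα hαq hi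
  · exact mul_neg_of_pos_of_neg (by positivity) (qSubPow_one_neg hq0 hq1 hβ hβq hj)

theorem neg_one_pow_mul_eval_one_qHahnPoly_neg (hq0 : 0 < q) (hq1 : q < 1) (hα : 1 < α)
    (hαq : α * q < 1) (hβ : 0 ≤ β) (hn : n ≤ N) (hn0 : n ≠ 0) (hB : α * β * q ^ n * q⁻¹ < 1) :
    (-1) ^ n * (qHahnPoly q α β N n).eval 1 < 0 := by
  rw [eval_one_qHahnPoly hq0.ne' (not_isOfFinOrder_of_pos_of_lt_one hq0 hq1), ← mul_assoc,
    mul_div_assoc']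
  exact mul_neg_of_pos_of_neg
    (div_pos (neg_one_pow_mul_qSubPow_inv_pow_pos hq0 hq1 hn)
      (qSubPow_one_pos hq0 hq1 (by positivity) hB n))
    (qSubPow_one_neg hq0 hq1 hα hαq hn0)

theorem eval_inv_pow_qHahnPoly_neg (hq0 : 0 < q) (hq1 : q < 1) (hα : 0 < α) (hβ : 1 < β)
    (hβq : β * q < 1) (hn : n ≤ N) (hn0 : n ≠ 0) (hB : α * β * q ^ n * q⁻¹ < 1) :
    (qHahnPoly q α β N n).eval (q⁻¹ ^ N) < 0 := by
  have hend := mul_eval_inv_pow_qHahnPoly hq0.ne' (not_isOfFinOrder_of_pos_of_lt_one hq0 hq1) α β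
    fun m hm => qSubPow_inv_pow_ne_zero hq0 hq1 (hm.trans hn)
  have hpow : 0 < (-1) ^ n * qSubPow 0 1 q n :=
    neg_one_pow_mul_qSubPow_pos fun j _ => by positivity
  refine (pos_iff_neg_of_mul_neg ?_).1 hpow
  rw [mul_assoc, hend, ← mul_assoc, mul_div_assoc']
  exact mul_neg_of_pos_of_neg
    (div_pos (neg_one_pow_mul_qSubPow_inv_pow_pos hq0 hq1 hn)
      (qSubPow_one_pos hq0 hq1 (by positivity) hB n))
    (mul_neg_of_pos_of_neg (by positivity) (qSubPow_one_neg hq0 hq1 hβ hβq hn0))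

theorem mul_pow_mul_inv_lt_one (hq0 : 0 < q) (hq1 : q < 1) (hα : 0 < α) (hαq : α * q < 1)
    (hβ : 0 < β) (hβq : β * q < 1) (hn : 2 ≤ n) (hn2 : n = 2 → α * β * q < 1) :
    α * β * q ^ n * q⁻¹ < 1 := by
  obtain ⟨k, rfl⟩ := Nat.exists_eq_add_of_le' hn
  rw [pow_add, pow_two, mul_assoc, ← mul_assoc (q ^ k), mul_inv_cancel_right₀ hq0.ne', ← pow_succ]
  rcases k.eq_zero_or_pos with rfl | hk
  · simpa using hn2 rfl
  · calc α * β * q ^ (k + 1) ≤ α * β * q ^ 2 := by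
          gcongr ?_ * ?_
          exact pow_le_pow_of_le_one hq0.le hq1.le (by omega)
      _ = (α * q) * (β * q) := by ring
      _ < 1 := mul_lt_one_of_nonneg_of_lt_one_left (by positivity) hαq hβq.le

theorem qSubPow_mul_pow_mul_inv_ne_zero (hq0 : 0 < q) (hq1 : q < 1) (hα : 1 < α) (hαq : α * q < 1)
    (hβ : 1 < β) (hβq : β * q < 1) (hn2 : n = 2 → α * β * q < 1) :
    qSubPow 1 (α * β * q ^ n * q⁻¹) q n ≠ 0 := by
  match n with
  | 0 => simp
  | 1 =>
    have hαβ : 1 < α * β := one_lt_mul_of_lt_of_le hα hβ.le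
    simpa [qSubPow_succ, hq0.ne', sub_eq_zero] using hαβ.ne
  | k + 2 =>
    have hB := mul_pow_mul_inv_lt_one hq0 hq1 (by positivity) hαq (by positivity) hβq
      (Nat.le_add_left 2 k) hn2
    exact (qSubPow_one_pos hq0 hq1 (by positivity) hB _).ne'

theorem exists_finset_roots_Ioo_qHahnPoly (hq0 : 0 < q) (hq1 : q < 1) (hα : 1 < α)
    (hαq : α * q < 1) (hβ : 1 < β) (hβq : β * q < 1) {d : ℕ} (hP : qHahnPoly q α β N n ≠ 0)
    (hn : n ≤ N) (hd : d + 2 ≤ n) :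
    ∃ S : Finset ℝ, S.card = d ∧
      ∀ t ∈ S, t ∈ Set.Ioo 1 (q⁻¹ ^ N) ∧ (qHahnPoly q α β N n).IsRoot t := by
  have hmono : StrictMono fun i : ℕ => q⁻¹ ^ i := pow_right_strictMono₀ (one_lt_inv₀ hq0 |>.2 hq1)
  have hlattice : ∀ i ∈ Ioo 0 N, q⁻¹ ^ i ∈ Set.Ioo 1 (q⁻¹ ^ N) := fun i hi =>
    ⟨by simpa using hmono (mem_Ioo.1 hi).1, hmono (mem_Ioo.1 hi).2⟩
  refine exists_finset_roots_of_orthogonal (y := fun i => q⁻¹ ^ i)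
    (w := fun i => (q⁻¹ ^ i - 1) * (q⁻¹ ^ N - q⁻¹ ^ i) * qHahnWeight q α β i (N - i))
    hP Set.ordConnected_Ioo hlattice hmono.injective.injOn (fun i hi => ?_)
    (by rw [Nat.card_Ioo]; omega) fun r hr =>
      sum_Ioo_qHahnWeight_mul_eval_qHahnPoly_mul_eval hq0.ne'
        (not_isOfFinOrder_of_pos_of_lt_one hq0 hq1) α (by positivity) hn
        (fun m hm => qSubPow_inv_pow_ne_zero hq0 hq1 (hm.trans hn)) hd hr
  obtain ⟨h1, hN⟩ := hlattice i hi
  obtain ⟨hi0, hiN⟩ := mem_Ioo.1 hi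
  exact mul_pos (mul_pos (sub_pos.2 h1) (sub_pos.2 hN))
    (qHahnWeight_pos hq0 hq1 hα hαq hβ hβq hi0.ne' (Nat.sub_ne_zero_of_lt hiN))

theorem exists_finset_roots_qHahnPoly_of_two_le (hq0 : 0 < q) (hq1 : q < 1) (hα : 1 < α)
    (hαq : α * q < 1) (hβ : 1 < β) (hβq : β * q < 1) (hn : n ≤ N) (h2 : 2 ≤ n)
    (hn2 : n = 2 → α * β * q < 1) :
    ∃ T : Finset ℝ, T.card = n ∧ (∀ t ∈ T, (qHahnPoly q α β N n).IsRoot t) ∧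
      (∃ t ∈ T, t < 1) ∧ ∃ t ∈ T, q⁻¹ ^ N < t := by
  have hfin := not_isOfFinOrder_of_pos_of_lt_one hq0 hq1
  have hN := qSubPow_inv_pow_ne_zero hq0 hq1 hn
  have hB := mul_pow_mul_inv_lt_one hq0 hq1 (by positivity) hαq (by positivity) hβq h2 hn2
  have hB0 := (qSubPow_one_pos hq0 hq1 (by positivity) hB n).ne'
  have hmonic := monic_qHahnPoly hq0.ne' hfin hN hB0
  have hdeg := natDegree_qHahnPoly hq0.ne' hfin hN hB0
  have hn0 : n ≠ 0 := by omega
  obtain ⟨S, hcard, hS⟩ := exists_finset_roots_Ioo_qHahnPoly hq0 hq1 hα hαq hβ hβq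
    hmonic.ne_zero hn (Nat.sub_add_cancel h2).le
  obtain ⟨l, hl, hl_root⟩ : ∃ t < 1, (qHahnPoly q α β N n).IsRoot t := by
    refine exists_isRoot_lt_of_neg_one_pow_mul_eval_neg hmonic ?_
    rw [hdeg]
    exact neg_one_pow_mul_eval_one_qHahnPoly_neg hq0 hq1 hα hαq (by positivity) hn hn0 hB
  obtain ⟨u, hu, hu_root⟩ := exists_isRoot_gt_of_eval_neg hmonic
    (eval_inv_pow_qHahnPoly_neg hq0 hq1 (by positivity) hβ hβq hn hn0 hB)
  have h1N : 1 ≤ q⁻¹ ^ N := one_le_pow₀ (one_le_inv₀ hq0 |>.2 hq1.le)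
  have hu_notMem : u ∉ S := fun h => hu.not_gt (hS u h).1.2
  have hl_notMem : l ∉ insert u S := by
    rw [mem_insert, not_or]
    exact ⟨(hl.trans (h1N.trans_lt hu)).ne, fun h => hl.not_gt (hS l h).1.1⟩
  refine ⟨insert l (insert u S), ?_, ?_, ⟨l, by simp, hl⟩, u, by simp, hu⟩
  · rw [card_insert_of_notMem hl_notMem, card_insert_of_notMem hu_notMem, hcard]
    omega
  · exact forall_mem_insert _ _ _ |>.2 ⟨hl_root, forall_mem_insert _ _ _ |>.2
      ⟨hu_root, fun t ht => (hS t ht).2⟩⟩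

theorem exists_finset_roots_qHahnPoly (hq0 : 0 < q) (hq1 : q < 1) (hα : 1 < α)
    (hαq : α * q < 1) (hβ : 1 < β) (hβq : β * q < 1) (hn : n ≤ N)
    (hn2 : n = 2 → α * β * q < 1) :
    ∃ T : Finset ℝ, T.card = n ∧ (∀ t ∈ T, (qHahnPoly q α β N n).IsRoot t) ∧
      (2 ≤ n → (∃ t ∈ T, t < 1) ∧ ∃ t ∈ T, q⁻¹ ^ N < t) := by
  have hfin := not_isOfFinOrder_of_pos_of_lt_one hq0 hq1
  have hN := qSubPow_inv_pow_ne_zero hq0 hq1 hn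
  have hB := qSubPow_mul_pow_mul_inv_ne_zero hq0 hq1 hα hαq hβ hβq hn2
  have hmonic := monic_qHahnPoly hq0.ne' hfin hN hB
  have hdeg := natDegree_qHahnPoly hq0.ne' hfin hN hB
  obtain rfl | rfl | h2 : n = 0 ∨ n = 1 ∨ 2 ≤ n := by omega
  · exact ⟨∅, by simp⟩
  · obtain ⟨t, ht⟩ := exists_root_of_degree_eq_one
      ((degree_eq_iff_natDegree_eq hmonic.ne_zero).2 hdeg)
    exact ⟨{t}, by simpa using ht⟩
  · obtain ⟨T, hcard, hT, hends⟩ :=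
      exists_finset_roots_qHahnPoly_of_two_le hq0 hq1 hα hαq hβ hβq hn h2 hn2
    exact ⟨T, hcard, hT, fun _ => hends⟩

theorem qHahn_ofReal_eq_eval_map_qHahnPoly (hq0 : 0 < q) (hq1 : q < 1) (hα : 1 < α)
    (hαq : α * q < 1) (β : ℝ) (N n : ℕ) (x : ℂ) :
    qHahn (q : ℂ) ((α / q : ℝ) : ℂ) ((β / q : ℝ) : ℂ) N n x
      = ((qHahnPoly q α β N n).map Complex.ofRealHom).eval x := by
  have hfin : ¬IsOfFinOrder (q : ℂ) := by
    have := not_isOfFinOrder_of_pos_of_lt_one hq0 hq1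
    rw [isOfFinOrder_iff_pow_eq_one] at this ⊢
    exact_mod_cast this
  have hα0 : qSubPow 1 (α : ℂ) q n ≠ 0 := by
    have hreal : qSubPow 1 α q n ≠ 0 := by
      rcases eq_or_ne n 0 with rfl | hn0
      · simp
      · exact (qSubPow_one_neg hq0 hq1 hα hαq hn0).ne
    simpa [map_qSubPow] using (map_ne_zero Complex.ofRealHom).2 hreal
  rw [Complex.ofReal_div, Complex.ofReal_div, map_qHahnPoly,
    qHahn_eq_eval_qHahnPoly (Complex.ofReal_ne_zero.2 hq0.ne') hfin β N hα0]
  rfl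

end Real

/-- The polynomial is monic of degree `n`, so that its factorization over `ℂ` into linear factors
with the strictly increasing real numbers `z 0 < … < z (n - 1)` says that it has exactly `n`
complex zeros, all of them real and simple. -/
theorem theorem2p8 (q α β : ℝ) (hq0 : 0 < q) (hq1 : q < 1)
    (hα : 1 < α) (hαq : α * q < 1) (hβ : 1 < β) (hβq : β * q < 1)
    (N n : ℕ) (hn : n ≤ N) (hn2 : n = 2 → α * β * q < 1) :
    ∃ z : Fin n → ℝ, StrictMono z ∧
      (∀ x : ℂ, qHahn (q : ℂ) ((α / q : ℝ) : ℂ) ((β / q : ℝ) : ℂ) N n x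
        = ∏ j : Fin n, (x - (z j : ℂ))) ∧
      (∀ x : ℂ, qHahn (q : ℂ) ((α / q : ℝ) : ℂ) ((β / q : ℝ) : ℂ) N n x = 0
        ↔ ∃ j : Fin n, x = (z j : ℂ)) ∧
      ∀ h : 2 ≤ n, z ⟨0, by omega⟩ < 1 ∧ q ^ (-(N : ℤ)) < z ⟨n - 1, by omega⟩ := by
  have hfin := not_isOfFinOrder_of_pos_of_lt_one hq0 hq1
  have hN := qSubPow_inv_pow_ne_zero hq0 hq1 hn
  have hB := qSubPow_mul_pow_mul_inv_ne_zero hq0 hq1 hα hαq hβ hβq hn2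
  obtain ⟨T, hcard, hT, hends⟩ := exists_finset_roots_qHahnPoly hq0 hq1 hα hαq hβ hβq hn hn2
  have hfactor := monic_eq_prod_X_sub_C (monic_qHahnPoly hq0.ne' hfin hN hB) hT
    (hcard.trans (natDegree_qHahnPoly hq0.ne' hfin hN hB).symm)
  let z := T.orderEmbOfFin hcard
  have hprod (x : ℂ) : qHahn (q : ℂ) ((α / q : ℝ) : ℂ) ((β / q : ℝ) : ℂ) N n x
      = ∏ j : Fin n, (x - (z j : ℂ)) := by
    rw [qHahn_ofReal_eq_eval_map_qHahnPoly hq0 hq1 hα hαq, hfactor,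
      ← image_orderEmbOfFin_univ T hcard, prod_image z.injective.injOn]
    simp [Polynomial.map_prod, eval_prod, z]
  have hzero (x : ℂ) : qHahn (q : ℂ) ((α / q : ℝ) : ℂ) ((β / q : ℝ) : ℂ) N n x = 0
      ↔ ∃ j : Fin n, x = (z j : ℂ) := by
    simp only [hprod, prod_eq_zero_iff, mem_univ, true_and, sub_eq_zero]
  refine ⟨z, z.strictMono, hprod, hzero, fun h => ?_⟩
  obtain ⟨⟨l, hl, hl1⟩, u, hu, huN⟩ := hends h
  rw [orderEmbOfFin_zero hcard (by omega), orderEmbOfFin_last hcard (by omega), zpow_neg,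
    zpow_natCast, ← inv_pow]
  exact ⟨(min'_le T l hl).trans_lt hl1, huN.trans_le (le_max' T u hu)⟩
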